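/- Let $X$ be a complex Banach space and let $L(X)$ denote the bounded linear operators on $X$. For $T\in L(X)$ and a $T$-invariant subspace $M$ (i.e. $T(M)\subset M$), let $T_M\in L(M)$ denote the restriction of $T$ to $M$. Write $(M,N)\in \mathrm{Red}(T)$ if $M,N$ are closed $T$-invariant subspaces with $X=M\oplus N$. An operator is upper semi-Fredholm if its range is closed and its kernel is finite-dimensional, lower semi-Fredholm if its range has finite codimension, semi-Fredholm if it is one of the two, and Fredholm if it is both; the index of a semi-Fredholm operator $S$ is $\operatorname{ind}(S)=\dim\ker S-\operatorname{codim}\operatorname{ran}S\in\mathbb Z\cup\{\pm\infty\}$. An operator is quasi-nilpotent if its spectrum is contained in $\{0\}$. The operator $T$ is pseudo B-Fredholm if there is $(M,N)\in\mathrm{Red}(T)$ such that $T_M$ is Fredholm and $T_N$ is quasi-nilpotent; its index is $\operatorname{ind}(T):=\operatorname{ind}(T_M)$ for any $(M,N)\in\mathrm{Red}(T)$ with $T_M$ semi-Fredholm and $T_N$ quasi-nilpotent (this does not depend on the choice of $(M,N)$). **Proposition.** Let $T\in L(X)$ and let $A\subset X$ be a closed $T$-invariant subspace of finite codimension. If $T$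 is pseudo B-Fredholm, then $T_A$ is pseudo B-Fredholm and $\operatorname{ind}(T)=\operatorname{ind}(T_A)$. Conversely, if $A$ has a $T$-invariant complement (a $T$-invariant subspace $F$ with $X=A\oplus F$) and $T_A$ is pseudo B-Fredholm, then $T$ is pseudo B-Fredholm and $\operatorname{ind}(T)=\operatorname{ind}(T_A)$. -/

import Mathlib

open scoped ENNReal

noncomputable section

namespace PseudoBFredholm

variable {X : Type*} [NormedAddCommGroup X] [NormedSpace ℂ X]

/-- The dimension of the kernel of `T`, as an element of `ℕ ∪ {∞}`. -/
def nullity (T : X →L[ℂ] X) : ℕ∞ :=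
  Cardinal.toENat (Module.rank ℂ T.ker)

/-- The (algebraic) codimension of the range of `T`, as an element of `ℕ ∪ {∞}`. -/
def deficiency (T : X →L[ℂ] X) : ℕ∞ :=
  Cardinal.toENat (Module.rank ℂ (X ⧸ T.range))

/-- `T` is upper semi-Fredholm: its range is closed and its kernel is finite-dimensional. -/
def IsUpperSemiFredholm (T : X →L[ℂ] X) : Prop :=
  IsClosed (T.range : Set X) ∧ FiniteDimensional ℂ T.ker

/-- `T` is lower semi-Fredholm: its range has finite codimension. -/
def IsLowerSemiFredholm (T : X →L[ℂ] X) : Prop :=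
  FiniteDimensional ℂ (X ⧸ T.range)

/-- `T` is semi-Fredholm: upper semi-Fredholm or lower semi-Fredholm. -/
def IsSemiFredholm (T : X →L[ℂ] X) : Prop :=
  IsUpperSemiFredholm T ∨ IsLowerSemiFredholm T

/-- The index `dim N(T) - codim R(T)`, an element of `ℤ ∪ {-∞, ∞}` when `T` is semi-Fredholm (then
at most one of the two terms is infinite). -/
def semiFredholmIndex (T : X →L[ℂ] X) : EReal :=
  (((nullity T : ℕ∞) : ℝ≥0∞) : EReal) - (((deficiency T : ℕ∞) : ℝ≥0∞) : EReal)

/-- `T` is quasi-nilpotent: its spectrum has no point other than `0`. (On the zero space the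
spectrum is empty, and the only operator there counts as quasi-nilpotent.) -/
def IsQuasiNilpotent (T : X →L[ℂ] X) : Prop :=
  spectrum ℂ T ⊆ {0}

/-- `(M, N) ∈ Red(T)`: `M` and `N` are closed `T`-invariant subspaces with `X = M ⊕ N`. -/
structure Reduces (T : X →L[ℂ] X) (M N : Submodule ℂ X) : Prop where
  isClosed_left : IsClosed (M : Set X)
  isClosed_right : IsClosed (N : Set X)
  mapsTo_left : Set.MapsTo T M M
  mapsTo_right : Set.MapsTo T N N
  isCompl : IsCompl M N

/-- `T` is pseudo B-Fredholm: there is `(M, N) ∈ Red(T)` such that the restriction of `T` to `M` is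
Fredholm and the restriction of `T` to `N` is quasi-nilpotent. -/
def IsPseudoBFredholm (T : X →L[ℂ] X) : Prop :=
  ∃ (M N : Submodule ℂ X) (h : Reduces T M N),
    (T.restrict h.mapsTo_left).IsFredholm ∧ IsQuasiNilpotent (T.restrict h.mapsTo_right)

/-- `k` is the index of the restriction of `T` to `M`, for some `(M, N) ∈ Red(T)` such that the
restriction of `T` to `M` is semi-Fredholm and its restriction to `N` is quasi-nilpotent. -/
def IsIndexOf (T : X →L[ℂ] X) (k : EReal) : Prop :=
  ∃ (M N : Submodule ℂ X) (h : Reduces T M N),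
    IsSemiFredholm (T.restrict h.mapsTo_left) ∧ IsQuasiNilpotent (T.restrict h.mapsTo_right) ∧
      semiFredholmIndex (T.restrict h.mapsTo_left) = k

open Classical in
/-- The index of a pseudo semi-B-Fredholm operator `T`: the index of the restriction of `T` to `M`,
for any `(M, N) ∈ Red(T)` such that the restriction of `T` to `M` is semi-Fredholm and its
restriction to `N` is quasi-nilpotent. It has the value `0` if there is no such pair. -/
def index (T : X →L[ℂ] X) : EReal :=
  if h : ∃ k, IsIndexOf T k then h.choose else 0

end PseudoBFredholm

end

/-! Index. If `T = S ⊕ W` with `S` Fredholm and `W` quasi-nilpotent, then for small `c ≠ 0` the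
operator `W - c` is bijective, so `T - c` is Fredholm with the index of `S - c`, which is the index
of `S`. Hence the index of `T` is the index of `T - c` near `0`, whatever the decomposition
(`IsPseudoBFredholm.exists_index_eq`). For a fixed `c`, the inclusion of `A` has finite-dimensional
kernel and cokernel and intertwines `T_A - c` with `T - c`; additivity of the index makes the two
indices equal (`index_restrict_eq`).

Passing to `A`. An eigenvector of the map induced on `X ⧸ A` reduces the claim to `A = ker φ` with
`φ ∘ T = μ φ`. If `φ` vanishes on one summand of `X = M ⊕ N`, it suffices to cut down the other.
Otherwise `φ ≠ 0` on `N` forces `μ = 0`, and the decomposition is changed until `φ` vanishes on the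
Fredholm summand (`IsDecomp.isPseudoBFredholm_restrict_ker`). If `φ` kills every `ker Sᵏ`, then `M`
is replaced by the graph of some `L : M → N` with `W L = L S` (`exists_intertwiner`). If not, a
Jordan chain of `S` on which `φ` is nonzero is split off and moved to the quasi-nilpotent side
(`isCompl_orbitKer`).

Passing from `A` to `X`. The complement is finite-dimensional and is absorbed into the Fredholm
summand. -/

namespace PseudoBFredholm

open Module Function Filter Topology

/-! ### Algebraic Fredholm maps and additivity of the index -/

section Algebra

variable {U V W : Type*} [AddCommGroup U] [Module ℂ U] [AddCommGroup V] [Module ℂ V]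
  [AddCommGroup W] [Module ℂ W]

/-- A linear map with finite-dimensional kernel and cokernel. -/
structure AlgFredholm (f : U →ₗ[ℂ] V) : Prop where
  ker : FiniteDimensional ℂ f.ker
  coker : FiniteDimensional ℂ (V ⧸ f.range)

theorem AlgFredholm.of_bijective {f : U →ₗ[ℂ] V} (h : Bijective f) : AlgFredholm f := by
  constructor
  · rw [LinearMap.ker_eq_bot.2 h.1]; infer_instance
  · rw [LinearMap.range_eq_top.2 h.2]; infer_instance

theorem index_of_bijective {f : U →ₗ[ℂ] V} (h : Bijective f) : f.index = 0 :=
  LinearEquiv.index_eq_zero (e := LinearEquiv.ofBijective f h)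

/-- A piece of the kernel-cokernel sequence of a composite: it bounds the cokernel of `f` by `ker g`
and the cokernel of `g ∘ f`. -/
theorem exact_ker_coker (f : U →ₗ[ℂ] V) (g : V →ₗ[ℂ] W) :
    Exact (f.range.mkQ ∘ₗ g.ker.subtype)
      (f.range.mapQ (g ∘ₗ f).range g (by rw [← Submodule.map_le_iff_le_comap, LinearMap.range_comp])) := by
  rw [LinearMap.exact_iff]
  simp [LinearMap.range_comp, Submodule.ker_mapQ, Submodule.comap_map_eq]

theorem AlgFredholm.comp {f : U →ₗ[ℂ] V} {g : V →ₗ[ℂ] W} (hg : AlgFredholm g)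
    (hf : AlgFredholm f) : AlgFredholm (g ∘ₗ f) := by
  have := hf.ker
  have := hf.coker
  have := hg.ker
  have := hg.coker
  constructor
  · rw [LinearMap.ker_comp]; infer_instance
  · rw [LinearMap.range_comp]; infer_instance

theorem AlgFredholm.index_comp {f : U →ₗ[ℂ] V} {g : V →ₗ[ℂ] W} (hg : AlgFredholm g)
    (hf : AlgFredholm f) : (g ∘ₗ f).index = g.index + f.index := by
  have := hf.ker
  have := hf.coker
  have := hg.ker
  have := hg.coker
  exact LinearMap.index_comp g

theorem AlgFredholm.of_comp_left {f : U →ₗ[ℂ] V} {g : V →ₗ[ℂ] W} (hg : AlgFredholm g)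
    (h : AlgFredholm (g ∘ₗ f)) : AlgFredholm f := by
  have := h.ker
  have := h.coker
  have := hg.ker
  refine ⟨Submodule.finiteDimensional_of_le (LinearMap.ker_le_ker_comp f g), ?_⟩
  have := isNoetherian_of_range_eq_ker _ _ (exact_ker_coker f g).linearMap_ker_eq.symm
  infer_instance

theorem AlgFredholm.of_comp_right {f : U →ₗ[ℂ] V} {g : V →ₗ[ℂ] W} (hf : AlgFredholm f)
    (h : AlgFredholm (g ∘ₗ f)) : AlgFredholm g := by
  have := h.ker
  have := h.coker
  have := hf.coker
  constructor
  · let f₁ : (g ∘ₗ f).ker →ₗ[ℂ] g.ker := f.restrict <| by simp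
    have : Exact f₁ (f.range.mkQ ∘ₗ g.ker.subtype) := by
      rw [LinearMap.exact_iff]
      simp only [LinearMap.ker_comp, Submodule.ker_mkQ]
      ext ⟨x, hx⟩
      constructor
      · rintro ⟨y, rfl : f y = x⟩
        exact ⟨⟨y, hx⟩, rfl⟩
      · rintro ⟨y, hy⟩
        exact ⟨y, congrArg Subtype.val hy⟩
    have := isNoetherian_of_range_eq_ker _ _ this.linearMap_ker_eq.symm
    infer_instance
  · exact Module.Finite.of_surjective _ (Submodule.factor_surjective (LinearMap.range_comp_le_range f g))

theorem AlgFredholm.subtype (A : Submodule ℂ U) [FiniteDimensional ℂ (U ⧸ A)] :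
    AlgFredholm A.subtype := by
  constructor
  · rw [Submodule.ker_subtype]; infer_instance
  · rw [Submodule.range_subtype]; infer_instance

/-- The restriction of a map to an invariant subspace of finite codimension. -/
theorem algFredholm_iff_of_intertwine {i : U →ₗ[ℂ] V} {f : U →ₗ[ℂ] U} {g : V →ₗ[ℂ] V}
    (hi : AlgFredholm i) (h : g ∘ₗ i = i ∘ₗ f) : AlgFredholm f ↔ AlgFredholm g := by
  refine ⟨fun hf ↦ .of_comp_right hi ?_, fun hg ↦ .of_comp_left hi ?_⟩
  · rw [h]; exact hi.comp hf
  · rw [← h]; exact hg.comp hi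

/-- Computing the index of `g ∘ i = i ∘ f` in two ways, the index of `i` cancels, so it need not be
zero. -/
theorem index_eq_of_intertwine {i : U →ₗ[ℂ] V} {f : U →ₗ[ℂ] U} {g : V →ₗ[ℂ] V}
    (hi : AlgFredholm i) (h : g ∘ₗ i = i ∘ₗ f) (hf : AlgFredholm f) : f.index = g.index := by
  have hg := (algFredholm_iff_of_intertwine hi h).1 hf
  have h1 := hg.index_comp hi
  have h2 := hi.index_comp hf
  rw [h] at h1
  lia

theorem surjective_of_injective_of_index {f : U →ₗ[ℂ] V} (hf : AlgFredholm f)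
    (hi : Injective f) (h0 : f.index = 0) : Surjective f := by
  have := hf.coker
  rw [LinearMap.index_of_injective hi] at h0
  have : finrank ℂ (V ⧸ f.range) = 0 := by lia
  rw [finrank_zero_iff, Submodule.Quotient.subsingleton_iff] at this
  exact LinearMap.range_eq_top.1 this

theorem algFredholm_inl [FiniteDimensional ℂ V] : AlgFredholm (LinearMap.inl ℂ U V) := by
  constructor
  · rw [LinearMap.ker_eq_bot.2 LinearMap.inl_injective]; infer_instance
  · exact ((LinearMap.inl ℂ U V).range.quotEquivOfEq _ (LinearMap.range_inl ℂ U V) ≪≫ₗ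
      (LinearMap.snd ℂ U V).quotKerEquivOfSurjective LinearMap.snd_surjective).symm.finiteDimensional

theorem index_inl [FiniteDimensional ℂ V] : (LinearMap.inl ℂ U V).index = - finrank ℂ V := by
  rw [LinearMap.index_of_injective LinearMap.inl_injective]
  rw [((LinearMap.inl ℂ U V).range.quotEquivOfEq _ (LinearMap.range_inl ℂ U V) ≪≫ₗ
      (LinearMap.snd ℂ U V).quotKerEquivOfSurjective LinearMap.snd_surjective).finrank_eq]

theorem algFredholm_fst [FiniteDimensional ℂ V] : AlgFredholm (LinearMap.fst ℂ U V) := by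
  refine .of_comp_right algFredholm_inl ?_
  exact .of_bijective bijective_id

theorem index_fst [FiniteDimensional ℂ V] : (LinearMap.fst ℂ U V).index = finrank ℂ V := by
  have h := (algFredholm_fst (U := U) (V := V)).index_comp algFredholm_inl
  have h2 : (LinearMap.fst ℂ U V ∘ₗ LinearMap.inl ℂ U V).index = 0 :=
    index_of_bijective bijective_id
  rw [index_inl] at h
  lia

/-- A block matrix with finite-dimensional borders. -/
theorem algFredholm_border {G H : Type*} [AddCommGroup G] [Module ℂ G] [AddCommGroup H] [Module ℂ H]
    [FiniteDimensional ℂ G] [FiniteDimensional ℂ H] {f : U →ₗ[ℂ] V} {F : U × G →ₗ[ℂ] V × H}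
    (h : ∀ x, (F (x, 0)).1 = f x) : AlgFredholm f ↔ AlgFredholm F := by
  have h' : f = LinearMap.fst ℂ V H ∘ₗ (F ∘ₗ LinearMap.inl ℂ U G) := by
    ext x; simp [h]
  constructor
  · intro hf
    rw [h'] at hf
    exact .of_comp_right algFredholm_inl (.of_comp_left algFredholm_fst hf)
  · intro hF
    rw [h']
    exact algFredholm_fst.comp (hF.comp algFredholm_inl)

/-- The corner `f` is `fst ∘ F ∘ inl`, where `fst` has index `dim H` and `inl` has index `-dim G`.
-/
theorem index_border {G H : Type*} [AddCommGroup G] [Module ℂ G] [AddCommGroup H] [Module ℂ H]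
    [FiniteDimensional ℂ G] [FiniteDimensional ℂ H] {f : U →ₗ[ℂ] V} {F : U × G →ₗ[ℂ] V × H}
    (h : ∀ x, (F (x, 0)).1 = f x) (hf : AlgFredholm f) :
    F.index = f.index + finrank ℂ G - finrank ℂ H := by
  have h' : f = LinearMap.fst ℂ V H ∘ₗ (F ∘ₗ LinearMap.inl ℂ U G) := by
    ext x; simp [h]
  have hF := (algFredholm_border h).1 hf
  have h1 := algFredholm_fst.index_comp (hF.comp algFredholm_inl)
  rw [← h', hF.index_comp algFredholm_inl, index_fst, index_inl] at h1
  lia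

/-- If `V = U ⊕ W` and `g` is the direct sum of `f` and of a bijection, then `f` and `g` have
isomorphic kernels and cokernels. -/
theorem exists_ker_coker_equiv {i : U →ₗ[ℂ] V} {j : W →ₗ[ℂ] V} {f : U →ₗ[ℂ] U} {g : V →ₗ[ℂ] V}
    {w : W →ₗ[ℂ] W} (hij : Bijective (i.coprod j)) (hi : g ∘ₗ i = i ∘ₗ f) (hj : g ∘ₗ j = j ∘ₗ w)
    (hw : Bijective w) :
    Nonempty (f.ker ≃ₗ[ℂ] g.ker) ∧ Nonempty ((U ⧸ f.range) ≃ₗ[ℂ] (V ⧸ g.range)) := by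
  have hi' : ∀ x, g (i x) = i (f x) := fun x ↦ LinearMap.congr_fun hi x
  have hj' : ∀ x, g (j x) = j (w x) := fun x ↦ LinearMap.congr_fun hj x
  have key : ∀ x y x' y', i x + j y = i x' + j y' → x = x' ∧ y = y' := fun x y x' y' h ↦ by
    have := @hij.1 (x, y) (x', y') (by simpa using h)
    simpa using this
  have hsurj : ∀ v, ∃ x y, i x + j y = v := fun v ↦ by
    obtain ⟨⟨x, y⟩, h⟩ := hij.2 v
    exact ⟨x, y, by simpa using h⟩
  constructor
  · have hm : ∀ x ∈ f.ker, i x ∈ g.ker := fun x hx ↦ by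
      simp only [LinearMap.mem_ker] at hx ⊢
      rw [hi', hx, map_zero]
    refine ⟨LinearEquiv.ofBijective (i.restrict hm) ⟨fun x y hxy ↦ ?_, fun v ↦ ?_⟩⟩
    · have : i x = i y := congrArg Subtype.val hxy
      exact Subtype.ext (key x 0 y 0 (by simpa using this)).1
    · obtain ⟨x, y, h⟩ := hsurj v
      have hv : g v = 0 := v.2
      rw [← h, map_add, hi', hj'] at hv
      obtain ⟨h1, h2⟩ := key _ _ 0 0 (hv.trans (by simp))
      have : y = 0 := hw.1 (h2.trans (map_zero w).symm)
      refine ⟨⟨x, h1⟩, Subtype.ext ?_⟩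
      simpa [this] using h
  · have hm : f.range ≤ g.range.comap i := by
      rintro _ ⟨x, rfl⟩
      exact ⟨i x, hi' x⟩
    refine ⟨LinearEquiv.ofBijective (f.range.mapQ g.range i hm) ⟨?_, fun v ↦ ?_⟩⟩
    · rw [← LinearMap.ker_eq_bot, Submodule.ker_mapQ, ← le_bot_iff]
      rintro _ ⟨x, ⟨v, hv⟩, rfl⟩
      obtain ⟨a, b, rfl⟩ := hsurj v
      rw [map_add, hi', hj'] at hv
      obtain ⟨h1, -⟩ := key _ _ x 0 (hv.trans (by simp))
      simpa using ⟨a, h1⟩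
    · obtain ⟨v, rfl⟩ := Submodule.mkQ_surjective _ v
      obtain ⟨x, y, rfl⟩ := hsurj v
      obtain ⟨y, rfl⟩ := hw.2 y
      refine ⟨Submodule.mkQ _ x, ?_⟩
      simp only [Submodule.mkQ_apply, Submodule.mapQ_apply, Submodule.Quotient.eq]
      exact ⟨-j y, by simp [hj']⟩

theorem algFredholm_iff_of_directSum {i : U →ₗ[ℂ] V} {j : W →ₗ[ℂ] V} {f : U →ₗ[ℂ] U}
    {g : V →ₗ[ℂ] V} {w : W →ₗ[ℂ] W} (hij : Bijective (i.coprod j)) (hi : g ∘ₗ i = i ∘ₗ f)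
    (hj : g ∘ₗ j = j ∘ₗ w) (hw : Bijective w) :
    AlgFredholm f ↔ AlgFredholm g := by
  obtain ⟨⟨a⟩, ⟨b⟩⟩ := exists_ker_coker_equiv hij hi hj hw
  constructor
  · rintro ⟨h1, h2⟩
    exact ⟨a.finiteDimensional, b.finiteDimensional⟩
  · rintro ⟨h1, h2⟩
    exact ⟨a.symm.finiteDimensional, b.symm.finiteDimensional⟩

theorem index_eq_of_directSum {i : U →ₗ[ℂ] V} {j : W →ₗ[ℂ] V} {f : U →ₗ[ℂ] U} {g : V →ₗ[ℂ] V}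
    {w : W →ₗ[ℂ] W} (hij : Bijective (i.coprod j)) (hi : g ∘ₗ i = i ∘ₗ f) (hj : g ∘ₗ j = j ∘ₗ w)
    (hw : Bijective w) : f.index = g.index := by
  obtain ⟨⟨a⟩, ⟨b⟩⟩ := exists_ker_coker_equiv hij hi hj hw
  rw [LinearMap.index_eq_finrank_sub, LinearMap.index_eq_finrank_sub, a.finrank_eq, b.finrank_eq]

theorem exists_submodule_finrank_eq (h : ¬ FiniteDimensional ℂ U) (k : ℕ) :
    ∃ E : Submodule ℂ U, FiniteDimensional ℂ E ∧ finrank ℂ E = k := by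
  have : (k : Cardinal) ≤ Module.rank ℂ U := by
    rw [FiniteDimensional, ← Module.rank_lt_aleph0_iff, not_lt] at h
    exact (Cardinal.natCast_lt_aleph0 (n := k)).le.trans h
  obtain ⟨s, hs, hli⟩ := (le_rank_iff_exists_linearIndependent_finset).1 this
  refine ⟨Submodule.span ℂ s, inferInstance, ?_⟩
  rw [finrank_span_finset_eq_card hli, hs]

end Algebra

/-! ### Closed range, and openness of surjectivity and of bounded-below injectivity -/

section Banach

variable {E F : Type*} [NormedAddCommGroup E] [NormedSpace ℂ E]
  [NormedAddCommGroup F] [NormedSpace ℂ F]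

theorem algFredholm_of_isFredholm {f : E →L[ℂ] F} (h : f.IsFredholm) :
    AlgFredholm (f : E →ₗ[ℂ] F) :=
  ⟨h.finite_ker, h.finite_coker⟩

/-- Finite codimension already closes the range: `f` is injective on a closed complement `K` of its
kernel, with the same range, and that range has a closed (finite-dimensional) algebraic complement.
-/
theorem isFredholm_of_algFredholm [CompleteSpace E] [CompleteSpace F] {f : E →L[ℂ] F} (h : AlgFredholm (f : E →ₗ[ℂ] F)) :
    f.IsFredholm := by
  have := h.ker
  have := h.coker
  obtain ⟨K, hK, hc⟩ := (Submodule.ClosedComplemented.of_finiteDimensional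
    f.ker).exists_isClosed_isCompl
  have := hK.completeSpace_coe
  obtain ⟨G, hG⟩ := f.range.exists_isCompl
  have : FiniteDimensional ℂ G := (f.range.quotientEquivOfIsCompl G hG).finiteDimensional
  have hker : (f.domRestrict K).ker = ⊥ := by
    rw [ContinuousLinearMap.toLinearMap_domRestrict, LinearMap.ker_domRestrict,
      ← Submodule.disjoint_iff_comap_eq_bot]
    exact hc.disjoint.symm
  have hran : (f.domRestrict K).range = f.range := by
    refine le_antisymm (f.toLinearMap.range_domRestrict_le_range K) ?_
    rintro _ ⟨x, rfl⟩
    obtain ⟨k, hk, y, hy, rfl⟩ := Submodule.mem_sup.1 (hc.sup_eq_top ▸ Submodule.mem_top : x ∈ _)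
    have hk' : f k = 0 := hk
    exact ⟨⟨y, hy⟩, by simp [hk']⟩
  have hcl : IsClosed (f.range : Set F) := by
    rw [← hran]
    exact (f.domRestrict K).closed_complemented_range_of_isCompl_of_ker_eq_bot G (hran ▸ hG)
      (Submodule.closed_of_finiteDimensional G) hker
  have := hcl.completeSpace_coe
  have : FiniteDimensional ℂ (E ⧸ K) :=
    (K.quotientEquivOfIsCompl f.ker hc.symm).symm.finiteDimensional
  have hm : Set.MapsTo f K f.range := fun x _ ↦ ⟨x, rfl⟩
  refine .of_isInvertible_restrict hK hcl hm ⟨.ofBijective (f.restrict hm) ?_ ?_, ?_⟩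
  · exact (LinearMap.ker_codRestrict _ _ _).trans hker
  · refine LinearMap.range_eq_top.2 fun ⟨y, hy⟩ ↦ ?_
    obtain ⟨x, hx⟩ : y ∈ (f.domRestrict K).range := hran ▸ hy
    exact ⟨x, Subtype.ext hx⟩
  · rfl

/-- A bounded nonlinear right inverse of `f` shows that the range of a nearby `g` contains a ball
around `0`; a subspace with nonempty interior is the whole space. -/
theorem eventually_surjective [CompleteSpace E] [CompleteSpace F] {f : E →L[ℂ] F} (hf : Surjective f) :
    ∀ᶠ g : E →L[ℂ] F in 𝓝 f, Surjective g := by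
  let r := f.nonlinearRightInverseOfSurjective (LinearMap.range_eq_top.2 hf)
  have hr : 0 < r.nnnorm := f.nonlinearRightInverseOfSurjective_nnnorm_pos _
  filter_upwards [Metric.ball_mem_nhds f (inv_pos.2 hr)] with g hg
  have ha : ApproximatesLinearOn g f Set.univ ‖g - f‖₊ := by
    intro x _ y _
    have := (g - f).le_opNorm (x - y)
    simpa [sub_sub_sub_comm] using this
  rw [mem_ball_iff_norm] at hg
  have h1 := ha.surjOn_closedBall_of_nonlinearRightInverse r (b := 0) zero_le_one
    (Set.subset_univ _)
  refine (LinearMap.range_eq_top (f := (g : E →ₗ[ℂ] F))).1 ?_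
  refine Submodule.eq_top_of_nonempty_interior' _ ⟨0, ?_⟩
  rw [mem_interior_iff_mem_nhds]
  rw [map_zero, mul_one] at h1
  refine mem_of_superset (Metric.closedBall_mem_nhds 0 (sub_pos.2 hg)) fun y hy ↦ ?_
  obtain ⟨x, -, hx⟩ := h1 hy
  exact ⟨x, hx⟩

theorem eventually_injective [CompleteSpace E] [CompleteSpace F] {f : E →L[ℂ] F} (hf : Injective f)
    (hc : IsClosed (Set.range f)) : ∀ᶠ g : E →L[ℂ] F in 𝓝 f, Injective g := by
  obtain ⟨K, hK⟩ := f.antilipschitz_of_injective_of_isClosed_range hf hc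
  rcases subsingleton_or_nontrivial E with hE | hE
  · exact .of_forall fun g ↦ injective_of_subsingleton g
  have hK0 : 0 < K := by
    obtain ⟨x, hx⟩ := exists_ne (0 : E)
    refine pos_iff_ne_zero.2 fun h0 ↦ hx ?_
    have := hK.le_mul_dist x 0
    simpa [h0] using this
  filter_upwards [Metric.ball_mem_nhds f (inv_pos.2 (NNReal.coe_pos.2 hK0))] with g hg
  rw [mem_ball_iff_norm] at hg
  refine (injective_iff_map_eq_zero g).2 fun x hx ↦ ?_
  by_contra hx0
  have h1 := hK.le_mul_dist x 0
  have h2 := (g - f).le_opNorm x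
  simp only [dist_zero_right, map_zero, sub_apply, hx, zero_sub,
    norm_neg] at h1 h2
  have h3 : ‖g - f‖ * ‖x‖ < (K : ℝ)⁻¹ * ‖x‖ := by
    have := norm_pos_iff.2 hx0
    gcongr
  have h4 : (K : ℝ) * ‖f x‖ < K * ((K : ℝ)⁻¹ * ‖x‖) := by
    gcongr
    exact h2.trans_lt h3
  rw [mul_inv_cancel_left₀ (by positivity)] at h4
  linarith

end Banach

/-! ### Stability of the index under `f ↦ f - c`, by bordering -/

section Index

variable {E : Type*} [NormedAddCommGroup E] [NormedSpace ℂ E]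

/-- The bordered operator `(x, g) ↦ (f x + g, p x)`. -/
def border (f : E →L[ℂ] E) (G : Submodule ℂ E) {V : Submodule ℂ E} (p : E →L[ℂ] V) :
    E × G →L[ℂ] E × V :=
  (f.coprod G.subtypeL).prod (p ∘L .fst ℂ E G)

theorem border_apply (f : E →L[ℂ] E) (G : Submodule ℂ E) {V : Submodule ℂ E} (p : E →L[ℂ] V)
    (x : E × G) : border f G p x = (f x.1 + x.2, p x.1) := rfl

theorem tendsto_border (f : E →L[ℂ] E) (G : Submodule ℂ E) {V : Submodule ℂ E} (p : E →L[ℂ] V) :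
    Tendsto (fun c : ℂ ↦ border (f - c • 1) G p) (𝓝[≠] 0) (𝓝 (border f G p)) := by
  obtain ⟨J, hJ⟩ : ∃ J : E × G →L[ℂ] E × V, ∀ x, J x = (x.1, 0) :=
    ⟨.inl ℂ E V ∘L .fst ℂ E G, fun _ ↦ rfl⟩
  have h : ∀ c : ℂ, border (f - c • 1) G p = border f G p - c • J := by
    intro c
    ext x <;> simp [border_apply, hJ]
  simp_rw [h]
  refine Tendsto.mono_left ?_ nhdsWithin_le_nhds
  have : Continuous fun c : ℂ ↦ border f G p - c • J := by fun_prop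
  have h0 : border f G p - (0 : ℂ) • J = border f G p := by
    ext x <;> simp
  have h1 := this.tendsto 0
  simp only [h0] at h1
  exact h1

theorem index_border_sub (f : E →L[ℂ] E) (G : Submodule ℂ E) {V : Submodule ℂ E} (p : E →L[ℂ] V)
    [FiniteDimensional ℂ G] [FiniteDimensional ℂ V] (hf : AlgFredholm (f : E →ₗ[ℂ] E)) :
    (border f G p : E × G →ₗ[ℂ] E × V).index =
      (f : E →ₗ[ℂ] E).index + finrank ℂ G - finrank ℂ V :=
  index_border (by simp [border_apply]) hf

theorem range_border {f : E →L[ℂ] E} {G V : Submodule ℂ E} {p : E →L[ℂ] V}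
    (hV : V ≤ f.ker) (hp : ∀ v : V, p v = v) :
    (border f G p : E × G →ₗ[ℂ] E × V).range = (f.range ⊔ G).prod ⊤ := by
  apply le_antisymm
  · rintro _ ⟨x, rfl⟩
    exact ⟨Submodule.add_mem_sup ⟨x.1, rfl⟩ x.2.2, trivial⟩
  · rintro ⟨y, v⟩ ⟨hy, -⟩
    obtain ⟨_, ⟨x, rfl⟩, g, hg, rfl⟩ := Submodule.mem_sup.1 hy
    have h1 : f v = 0 := hV v.2
    have h2 : f (p x) = 0 := hV (p x).2
    -- The correction `v - p x` lies in `V ≤ ker f`, so it leaves `f x` alone while moving the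
    -- second coordinate from `p x` to `v`.
    refine ⟨(x + (v - p x), ⟨g, hg⟩), ?_⟩
    ext <;> simp [border_apply, h1, h2, hp]

theorem border_injective {f : E →L[ℂ] E} {G : Submodule ℂ E} {p : E →L[ℂ] f.ker}
    (hG : Disjoint f.range G) (hp : ∀ v : f.ker, p v = v) : Injective (border f G p) := by
  refine (injective_iff_map_eq_zero _).2 fun ⟨x, g⟩ h ↦ ?_
  rw [border_apply, Prod.mk_eq_zero] at h
  obtain ⟨h1, h2⟩ := h
  have h3 : (g : E) = 0 := by
    refine Submodule.disjoint_def.1 hG g ⟨-x, ?_⟩ g.2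
    simpa using neg_eq_of_add_eq_zero_right h1
  have h4 : f x = 0 := by simpa [h3] using h1
  have h5 := hp ⟨x, h4⟩
  rw [Prod.mk_eq_zero]
  exact ⟨congrArg Subtype.val (h5.symm.trans h2), Subtype.ext h3⟩

theorem exists_projection (V : Submodule ℂ E) [FiniteDimensional ℂ V] :
    ∃ p : E →L[ℂ] V, ∀ v : V, p v = v :=
  Submodule.ClosedComplemented.of_finiteDimensional V

/-- Bordering by the kernel and by a complement of the range makes `f` bijective. Bijectivity
survives small perturbations, so both bordered operators have index `0`, and the borders contribute
the same amount to each. -/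
theorem eventually_index_sub_smul [CompleteSpace E] {f : E →L[ℂ] E} (hf : AlgFredholm (f : E →ₗ[ℂ] E)) :
    ∀ᶠ c : ℂ in 𝓝[≠] 0, AlgFredholm ((f - c • 1 : E →L[ℂ] E) : E →ₗ[ℂ] E) ∧
      ((f - c • 1 : E →L[ℂ] E) : E →ₗ[ℂ] E).index = (f : E →ₗ[ℂ] E).index := by
  have := hf.ker
  have := hf.coker
  obtain ⟨p, hp⟩ := exists_projection f.ker
  obtain ⟨G, hG⟩ := f.range.exists_isCompl
  have : FiniteDimensional ℂ G := (f.range.quotientEquivOfIsCompl G hG).finiteDimensional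
  have hr : (border f G p : E × G →ₗ[ℂ] E × f.ker).range = ⊤ := by
    rw [range_border le_rfl hp, hG.sup_eq_top, Submodule.prod_top]
  have hs : Surjective (border f G p) := LinearMap.range_eq_top.1 hr
  have hi := border_injective hG.disjoint hp
  filter_upwards [(tendsto_border f G p).eventually (eventually_surjective hs),
    (tendsto_border f G p).eventually (eventually_injective hi
      (by rw [hs.range_eq]; exact isClosed_univ))] with c h1 h2
  have h3 : AlgFredholm ((f - c • 1 : E →L[ℂ] E) : E →ₗ[ℂ] E) :=
    (algFredholm_border (F := (border (f - c • 1) G p : E × G →ₗ[ℂ] E × f.ker))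
      (by simp [border_apply])).2 (.of_bijective ⟨h2, h1⟩)
  refine ⟨h3, ?_⟩
  have h4 := index_border_sub (f - c • 1) G p h3
  have h5 := index_border_sub f G p hf
  rw [index_of_bijective ⟨h2, h1⟩] at h4
  rw [index_of_bijective ⟨hi, hs⟩] at h5
  lia

/-- An infinite-dimensional kernel would allow a surjective border with `V` as large as desired.
Nearby borders stay surjective, so have index at least `0`, whereas their index is `n + dim G - dim
V`. -/
theorem finiteDimensional_ker_of_eventually [CompleteSpace E] {f : E →L[ℂ] E} {n : ℤ}
    (hf : FiniteDimensional ℂ (E ⧸ f.range))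
    (h : ∀ᶠ c : ℂ in 𝓝[≠] 0, AlgFredholm ((f - c • 1 : E →L[ℂ] E) : E →ₗ[ℂ] E) ∧
      ((f - c • 1 : E →L[ℂ] E) : E →ₗ[ℂ] E).index = n) : FiniteDimensional ℂ f.ker := by
  by_contra hk
  obtain ⟨G, hG⟩ := f.range.exists_isCompl
  have : FiniteDimensional ℂ G := (f.range.quotientEquivOfIsCompl G hG).finiteDimensional
  -- This dimension makes `n + dim G - dim V` negative, also when `toNat` truncates to `0`.
  obtain ⟨V', hV', hd⟩ := exists_submodule_finrank_eq hk (n + finrank ℂ G + 1).toNat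
  let V := V'.map f.ker.subtype
  have hV : V ≤ f.ker := Submodule.map_subtype_le _ _
  have hVd : finrank ℂ V = (n + finrank ℂ G + 1).toNat := by
    rw [← hd]
    exact Submodule.finrank_map_subtype_eq f.ker V'
  obtain ⟨p, hp⟩ := exists_projection V
  have hs : Surjective (border f G p) := by
    have hr : (border f G p : E × G →ₗ[ℂ] E × V).range = ⊤ := by
      rw [range_border hV hp, hG.sup_eq_top, Submodule.prod_top]
    exact LinearMap.range_eq_top.1 hr
  obtain ⟨c, h1, h2, h3⟩ := (((tendsto_border f G p).eventually
    (eventually_surjective hs)).and h).exists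
  have h4 := index_border_sub (f - c • 1) G p h2
  rw [LinearMap.index_of_surjective h1] at h4
  lia

/-- Dual argument: with a large `G` off the range, the border is injective with closed range. Nearby
borders stay injective, so have index at most `0`, contradicting `n + dim G - dim ker f > 0`. -/
theorem finiteDimensional_coker_of_eventually [CompleteSpace E] {f : E →L[ℂ] E} {n : ℤ}
    (hf : FiniteDimensional ℂ f.ker) (hcl : IsClosed (f.range : Set E))
    (h : ∀ᶠ c : ℂ in 𝓝[≠] 0, AlgFredholm ((f - c • 1 : E →L[ℂ] E) : E →ₗ[ℂ] E) ∧
      ((f - c • 1 : E →L[ℂ] E) : E →ₗ[ℂ] E).index = n) : FiniteDimensional ℂ (E ⧸ f.range) := by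
  by_contra hk
  obtain ⟨C, hC⟩ := f.range.exists_isCompl
  have hk' : ¬ FiniteDimensional ℂ C := fun h ↦
    hk (f.range.quotientEquivOfIsCompl C hC).symm.finiteDimensional
  obtain ⟨G', hG', hd⟩ := exists_submodule_finrank_eq hk' (finrank ℂ f.ker - n + 1).toNat
  let G := G'.map C.subtype
  have hG : G ≤ C := Submodule.map_subtype_le _ _
  have hGd : finrank ℂ G = (finrank ℂ f.ker - n + 1).toNat := by
    rw [← hd]
    exact Submodule.finrank_map_subtype_eq C G'
  obtain ⟨p, hp⟩ := exists_projection f.ker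
  have hi := border_injective (hC.disjoint.mono_right hG) hp
  have hr : IsClosed (Set.range (border f G p)) := by
    have : Set.range (border f G p) = ((f.range ⊔ G : Submodule ℂ E) : Set E) ×ˢ Set.univ := by
      have := congrArg (fun S : Submodule ℂ _ ↦ (S : Set (E × f.ker))) (range_border (G := G) le_rfl hp)
      rwa [LinearMap.coe_range, Submodule.prod_coe, Submodule.top_coe] at this
    rw [this]
    exact (Submodule.isClosed_sup_finiteDimensional _ _ hcl).prod isClosed_univ
  obtain ⟨c, h1, h2, h3⟩ := (((tendsto_border f G p).eventually
    (eventually_injective hi hr)).and h).exists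
  have h4 := index_border_sub (f - c • 1) G p h2
  rw [LinearMap.index_of_injective h1] at h4
  lia

theorem semiFredholmIndex_of_algFredholm {f : E →L[ℂ] E} (hf : AlgFredholm (f : E →ₗ[ℂ] E)) :
    semiFredholmIndex f = (((f : E →ₗ[ℂ] E).index : ℝ) : EReal) := by
  have := hf.ker
  have := hf.coker
  have h1 : nullity f = (finrank ℂ f.ker : ℕ∞) := by
    rw [nullity, ← finrank_eq_rank, Cardinal.toENat_nat]
  have h2 : deficiency f = (finrank ℂ (E ⧸ f.range) : ℕ∞) := by
    rw [deficiency, ← finrank_eq_rank, Cardinal.toENat_nat]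
  rw [semiFredholmIndex, h1, h2, LinearMap.index_eq_finrank_sub]
  push_cast
  rfl

theorem semiFredholmIndex_eq_of_eventually [CompleteSpace E] {f : E →L[ℂ] E} {n : ℤ} (hf : IsSemiFredholm f)
    (h : ∀ᶠ c : ℂ in 𝓝[≠] 0, AlgFredholm ((f - c • 1 : E →L[ℂ] E) : E →ₗ[ℂ] E) ∧
      ((f - c • 1 : E →L[ℂ] E) : E →ₗ[ℂ] E).index = n) :
    semiFredholmIndex f = ((n : ℝ) : EReal) := by
  have hF : AlgFredholm (f : E →ₗ[ℂ] E) := by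
    rcases hf with ⟨hcl, hk⟩ | hf
    · exact ⟨hk, finiteDimensional_coker_of_eventually hk hcl h⟩
    · exact ⟨finiteDimensional_ker_of_eventually hf h, hf⟩
  rw [semiFredholmIndex_of_algFredholm hF]
  obtain ⟨c, h1, h2⟩ := ((eventually_index_sub_smul hF).and h).exists
  rw [← h1.2, h2.2]

end Index

/-! ### Quasi-nilpotent operators -/

section QuasiNilpotent

variable {N : Type*} [NormedAddCommGroup N] [NormedSpace ℂ N] [CompleteSpace N]

theorem isQuasiNilpotent_iff {W : N →L[ℂ] N} :
    IsQuasiNilpotent W ↔ ∀ c : ℂ, c ≠ 0 → Bijective (W - c • 1 : N →L[ℂ] N) := by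
  have h : ∀ c : ℂ, c ∈ spectrum ℂ W ↔ ¬ Bijective (W - c • 1 : N →L[ℂ] N) := fun c ↦ by
    rw [spectrum.mem_iff, Algebra.algebraMap_eq_smul_one, IsUnit.sub_iff,
      ContinuousLinearMap.isUnit_iff_bijective]
  constructor
  · intro hW c hc
    by_contra hb
    exact hc (hW ((h c).2 hb))
  · intro hW c hc
    by_contra hc0
    exact (h c).1 hc (hW c hc0)

theorem IsQuasiNilpotent.summable {W : N →L[ℂ] N} (hW : IsQuasiNilpotent W) {r : ℝ} (hr : 0 ≤ r) :
    Summable fun k : ℕ ↦ ‖W ^ k‖ * r ^ k := by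
  have h0 : spectralRadius ℂ W = 0 := by
    refine le_antisymm (iSup₂_le fun c hc ↦ ?_) bot_le
    have : c = 0 := hW hc
    simp [this]
  have h1 := spectrum.pow_norm_pow_one_div_tendsto_nhds_spectralRadius W
  rw [h0] at h1
  -- Chosen so that `e * r ≤ 1 / 2`; by Gelfand's formula `‖W ^ k‖ ≤ e ^ k` for large `k`.
  set e : ℝ := (2 * (r + 1))⁻¹ with he
  have he0 : 0 < e := by positivity
  have h2 := h1.eventually (gt_mem_nhds (ENNReal.ofReal_pos.2 he0))
  refine Summable.of_norm_bounded_eventually_nat (g := fun k ↦ (1 / 2 : ℝ) ^ k)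
    summable_geometric_two ?_
  filter_upwards [h2, eventually_gt_atTop 0] with k hk hk0
  have h3 : ‖W ^ k‖ ^ (1 / k : ℝ) ≤ e := ((ENNReal.ofReal_lt_ofReal_iff he0).1 hk).le
  have h4 : ‖W ^ k‖ ≤ e ^ k := by
    have := pow_le_pow_left₀ (by positivity) h3 k
    rwa [one_div, Real.rpow_inv_natCast_pow (norm_nonneg _) hk0.ne'] at this
  rw [Real.norm_of_nonneg (by positivity)]
  calc ‖W ^ k‖ * r ^ k ≤ e ^ k * r ^ k := by gcongr
    _ = (e * r) ^ k := (mul_pow _ _ _).symm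
    _ ≤ (1 / 2) ^ k := by
        gcongr
        rw [he, inv_mul_le_iff₀ (by positivity)]
        linarith

/-- The restriction of a quasi-nilpotent operator to a subspace of finite codimension. -/
theorem IsQuasiNilpotent.of_intertwine {N₀ : Type*} [NormedAddCommGroup N₀] [NormedSpace ℂ N₀]
    [CompleteSpace N₀] {W : N →L[ℂ] N} (hW : IsQuasiNilpotent W) {i : N₀ →L[ℂ] N}
    {W₀ : N₀ →L[ℂ] N₀} (hi : AlgFredholm (i : N₀ →ₗ[ℂ] N)) (hinj : Injective i)
    (h : ∀ x, W (i x) = i (W₀ x)) : IsQuasiNilpotent W₀ := by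
  rw [isQuasiNilpotent_iff] at hW ⊢
  intro c hc
  have hb := hW c hc
  have hx : ∀ x, (W - c • 1 : N →L[ℂ] N) (i x) = i ((W₀ - c • 1 : N₀ →L[ℂ] N₀) x) := fun x ↦ by
    simp [h]
  have h1 : ((W - c • 1 : N →L[ℂ] N) : N →ₗ[ℂ] N) ∘ₗ (i : N₀ →ₗ[ℂ] N) =
      (i : N₀ →ₗ[ℂ] N) ∘ₗ ((W₀ - c • 1 : N₀ →L[ℂ] N₀) : N₀ →ₗ[ℂ] N₀) := LinearMap.ext hx
  have h2 := (algFredholm_iff_of_intertwine hi h1).2 (.of_bijective hb)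
  have h3 : Injective (W₀ - c • 1 : N₀ →L[ℂ] N₀) := fun x y hxy ↦ by
    refine hinj (hb.1 ?_)
    rw [hx, hx, hxy]
  -- Injectivity is inherited from `W - c`; index `0`, also inherited, then yields surjectivity.
  refine ⟨h3, surjective_of_injective_of_index h2 h3 ?_⟩
  rw [index_eq_of_intertwine hi h1 h2, index_of_bijective hb]

theorem IsQuasiNilpotent.prodMap {E : Type*} [NormedAddCommGroup E] [NormedSpace ℂ E]
    [CompleteSpace E] {W : N →L[ℂ] N} {Z : E →L[ℂ] E} (hW : IsQuasiNilpotent W)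
    (hZ : IsQuasiNilpotent Z) : IsQuasiNilpotent (W.prodMap Z) := by
  rw [isQuasiNilpotent_iff] at hW hZ ⊢
  intro c hc
  exact (hW c hc).prodMap (hZ c hc)

end QuasiNilpotent

/-! ### Decompositions given by embeddings, and independence of the index -/

section Decomp

variable {X M N : Type*} [NormedAddCommGroup X] [NormedSpace ℂ X]
  [NormedAddCommGroup M] [NormedSpace ℂ M] [NormedAddCommGroup N] [NormedSpace ℂ N]

/-- `T` is the direct sum of `S` and `W` with respect to the decomposition of the space given by
the embeddings `i` and `j`. -/
structure IsDecomp (T : X →L[ℂ] X) (i : M →L[ℂ] X) (j : N →L[ℂ] X) (S : M →L[ℂ] M)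
    (W : N →L[ℂ] N) : Prop where
  bij : Bijective (i.coprod j)
  left : ∀ x, T (i x) = i (S x)
  right : ∀ x, T (j x) = j (W x)

variable {T : X →L[ℂ] X} {i : M →L[ℂ] X} {j : N →L[ℂ] X} {S : M →L[ℂ] M} {W : N →L[ℂ] N}

theorem IsDecomp.symm (h : IsDecomp T i j S W) : IsDecomp T j i W S := by
  refine ⟨?_, h.right, h.left⟩
  have : ⇑(j.coprod i) = i.coprod j ∘ Prod.swap := by
    ext x
    simp [add_comm]
  rw [this]
  exact h.bij.comp Prod.swap_bijective

theorem IsDecomp.exists_eq (h : IsDecomp T i j S W) (x : X) : ∃ m n, i m + j n = x := by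
  obtain ⟨⟨m, n⟩, hx⟩ := h.bij.2 x
  exact ⟨m, n, by simpa using hx⟩

theorem IsDecomp.eq_of_eq (h : IsDecomp T i j S W) {m m' : M} {n n' : N}
    (he : i m + j n = i m' + j n') : m = m' ∧ n = n' := by
  have := @h.bij.1 (m, n) (m', n') (by simpa using he)
  simpa using this

theorem IsDecomp.injective_left (h : IsDecomp T i j S W) : Injective i := fun x y hxy ↦
  (h.eq_of_eq (n := 0) (n' := 0) (by rw [hxy])).1

theorem IsDecomp.isCompl_range (h : IsDecomp T i j S W) : IsCompl i.range j.range := by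
  refine IsCompl.of_eq ?_ ?_
  · rw [eq_bot_iff]
    rintro _ ⟨⟨m, rfl⟩, n, hn⟩
    have := h.eq_of_eq (m := 0) (m' := m) (n := n) (n' := 0) (by simpa using hn)
    simp [← this.1]
  · rw [eq_top_iff]
    rintro x -
    obtain ⟨m, n, rfl⟩ := h.exists_eq x
    exact Submodule.add_mem_sup ⟨m, rfl⟩ ⟨n, rfl⟩

theorem IsDecomp.isClosed_range [CompleteSpace X] [CompleteSpace M] [CompleteSpace N]
    (h : IsDecomp T i j S W) : IsClosed (i.range : Set X) := by
  let e : (M × N) ≃L[ℂ] X := .ofBijective (i.coprod j) (LinearMap.ker_eq_bot.2 h.bij.1)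
    (LinearMap.range_eq_top.2 h.bij.2)
  have he : ∀ m n, e (m, n) = i m + j n := fun m n ↦ by simp [e]
  have : (i.range : Set X) = e '' (Set.univ ×ˢ {0}) := by
    ext x
    constructor
    · rintro ⟨m, rfl⟩
      exact ⟨(m, 0), by simp, by simp [he]⟩
    · rintro ⟨⟨m, n⟩, ⟨-, rfl⟩, rfl⟩
      exact ⟨m, by simp [he]⟩
  rw [this]
  exact e.toHomeomorph.isClosed_image.2 (isClosed_univ.prod isClosed_singleton)

theorem IsDecomp.mapsTo_range (h : IsDecomp T i j S W) : Set.MapsTo T i.range i.range := by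
  rintro _ ⟨m, rfl⟩
  exact ⟨S m, (h.left m).symm⟩

theorem IsDecomp.reduces [CompleteSpace X] [CompleteSpace M] [CompleteSpace N]
    (h : IsDecomp T i j S W) : Reduces T i.range j.range :=
  ⟨h.isClosed_range, h.symm.isClosed_range, h.mapsTo_range, h.symm.mapsTo_range, h.isCompl_range⟩

theorem IsDecomp.isPseudoBFredholm [CompleteSpace X] [CompleteSpace M] [CompleteSpace N]
    (h : IsDecomp T i j S W) (hS : AlgFredholm (S : M →ₗ[ℂ] M)) (hW : IsQuasiNilpotent W) :
    IsPseudoBFredholm T := by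
  have h1 := h.isClosed_range.completeSpace_coe
  have h2 := h.symm.isClosed_range.completeSpace_coe
  refine ⟨_, _, h.reduces, isFredholm_of_algFredholm ?_, ?_⟩
  · have hb : Bijective i.rangeRestrict := ⟨fun x y hxy ↦ h.injective_left (congrArg Subtype.val hxy),
      i.toLinearMap.surjective_rangeRestrict⟩
    refine (algFredholm_iff_of_intertwine (i := (i.rangeRestrict : M →ₗ[ℂ] i.range))
      (.of_bijective hb) ?_).1 hS
    ext x
    exact h.left x
  · have he : Bijective j.rangeRestrict := ⟨fun x y hxy ↦ h.symm.injective_left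
      (congrArg Subtype.val hxy), j.toLinearMap.surjective_rangeRestrict⟩
    let E : N ≃L[ℂ] j.range := .ofBijective j.rangeRestrict (LinearMap.ker_eq_bot.2 he.1)
      (LinearMap.range_eq_top.2 he.2)
    have hE : ∀ x, (E x : X) = j x := fun x ↦ rfl
    refine hW.of_intertwine (i := (E.symm : j.range →L[ℂ] N)) (.of_bijective E.symm.bijective)
      E.symm.injective fun x ↦ ?_
    obtain ⟨x, rfl⟩ := E.surjective x
    apply E.injective
    simp only [ContinuousLinearEquiv.coe_coe, ContinuousLinearEquiv.symm_apply_apply,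
      ContinuousLinearEquiv.apply_symm_apply]
    exact Subtype.ext (h.right x).symm

theorem Reduces.isDecomp {T : X →L[ℂ] X} {M N : Submodule ℂ X} (h : Reduces T M N) :
    IsDecomp T M.subtypeL N.subtypeL (T.restrict h.mapsTo_left) (T.restrict h.mapsTo_right) := by
  refine ⟨?_, fun _ ↦ rfl, fun _ ↦ rfl⟩
  exact (M.prodEquivOfIsCompl N h.isCompl).bijective

theorem IsDecomp.algFredholm_sub_smul_iff (h : IsDecomp T i j S W) {c : ℂ}
    (hW : Bijective (W - c • 1 : N →L[ℂ] N)) :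
    AlgFredholm ((S - c • 1 : M →L[ℂ] M) : M →ₗ[ℂ] M) ↔
      AlgFredholm ((T - c • 1 : X →L[ℂ] X) : X →ₗ[ℂ] X) := by
  refine algFredholm_iff_of_directSum (i := (i : M →ₗ[ℂ] X)) (j := (j : N →ₗ[ℂ] X)) h.bij
    ?_ ?_ hW
  · ext x; simp [h.left]
  · ext x; simp [h.right]

theorem IsDecomp.index_sub_smul (h : IsDecomp T i j S W) {c : ℂ}
    (hW : Bijective (W - c • 1 : N →L[ℂ] N)) :
    ((S - c • 1 : M →L[ℂ] M) : M →ₗ[ℂ] M).index =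
      ((T - c • 1 : X →L[ℂ] X) : X →ₗ[ℂ] X).index := by
  refine index_eq_of_directSum (i := (i : M →ₗ[ℂ] X)) (j := (j : N →ₗ[ℂ] X)) h.bij
    ?_ ?_ hW
  · ext x; simp [h.left]
  · ext x; simp [h.right]

/-- The index of a pseudo B-Fredholm operator `T` is the index of `T - c` for all small nonzero
`c`. -/
theorem IsPseudoBFredholm.exists_index_eq [CompleteSpace X] (hT : IsPseudoBFredholm T) :
    ∃ n : ℤ, (∀ᶠ c : ℂ in 𝓝[≠] 0, AlgFredholm ((T - c • 1 : X →L[ℂ] X) : X →ₗ[ℂ] X) ∧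
      ((T - c • 1 : X →L[ℂ] X) : X →ₗ[ℂ] X).index = n) ∧ index T = ((n : ℝ) : EReal) := by
  obtain ⟨M, N, h, hF, hq⟩ := hT
  have := h.isClosed_left.completeSpace_coe
  have := h.isClosed_right.completeSpace_coe
  have hF' := algFredholm_of_isFredholm hF
  have hev : ∀ᶠ c : ℂ in 𝓝[≠] 0, AlgFredholm ((T - c • 1 : X →L[ℂ] X) : X →ₗ[ℂ] X) ∧
      ((T - c • 1 : X →L[ℂ] X) : X →ₗ[ℂ] X).index =
        (T.restrict h.mapsTo_left : M →ₗ[ℂ] M).index := by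
    filter_upwards [eventually_index_sub_smul hF', self_mem_nhdsWithin] with c hc hc0
    have hb := isQuasiNilpotent_iff.1 hq c hc0
    exact ⟨(h.isDecomp.algFredholm_sub_smul_iff hb).1 hc.1,
      (h.isDecomp.index_sub_smul hb).symm.trans hc.2⟩
  refine ⟨_, hev, ?_⟩
  have hex : ∃ k, IsIndexOf T k := ⟨_, M, N, h, .inr hF'.coker, hq, rfl⟩
  -- The pair behind the chosen value may differ from `(M, N)` and is only known to be semi-Fredholm
  -- on `M'`; it is compared with `(M, N)` through `T - c`.
  obtain ⟨M', N', h', hs, hq', hk⟩ := hex.choose_spec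
  have := h'.isClosed_left.completeSpace_coe
  have := h'.isClosed_right.completeSpace_coe
  rw [index, dif_pos hex, ← hk]
  refine semiFredholmIndex_eq_of_eventually hs ?_
  filter_upwards [hev, self_mem_nhdsWithin] with c hc hc0
  have hb := isQuasiNilpotent_iff.1 hq' c hc0
  exact ⟨(h'.isDecomp.algFredholm_sub_smul_iff hb).2 hc.1,
    (h'.isDecomp.index_sub_smul hb).trans hc.2⟩

theorem index_restrict_eq [CompleteSpace X] {A : Submodule ℂ X} (hA : IsClosed (A : Set X))
    (hinv : Set.MapsTo T A A) [FiniteDimensional ℂ (X ⧸ A)] (hT : IsPseudoBFredholm T)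
    (hTA : IsPseudoBFredholm (T.restrict hinv)) : index T = index (T.restrict hinv) := by
  have := hA.completeSpace_coe
  obtain ⟨n, hn, h1⟩ := hT.exists_index_eq
  obtain ⟨n', hn', h2⟩ := hTA.exists_index_eq
  obtain ⟨c, hc, hc'⟩ := (hn.and hn').exists
  rw [h1, h2, ← hc.2, ← hc'.2,
    index_eq_of_intertwine (g := ((T - c • 1 : X →L[ℂ] X) : X →ₗ[ℂ] X)) (.subtype A) ?_ hc'.1]
  ext x
  simp
  rfl

end Decomp

/-! ### Generalized inverses and powers of Fredholm operators -/

section Adapted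

variable {M : Type*} [NormedAddCommGroup M] [NormedSpace ℂ M]

/-- A generalized inverse of a Fredholm operator leaving a given subspace invariant. -/
theorem exists_adapted_inverse [CompleteSpace M] {S : M →L[ℂ] M} (hS : AlgFredholm (S : M →ₗ[ℂ] M))
    {K : Submodule ℂ M} (hK : ∀ x, S x ∈ K → x ∈ K) :
    ∃ R : M →L[ℂ] M, (∀ x ∈ K, R x ∈ K) ∧ ∀ x, S (R (S x)) = S x := by
  have hF := isFredholm_of_algFredholm hS
  have := hS.ker
  have := hS.coker
  -- The complement `G` of the range is chosen to contain `C ⊓ K`, so that `K` splits as `(S.range ⊓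
  -- K) ⊔ (C ⊓ K)` with `R` zero on the second part. On the first, `S (R y) = y ∈ K` gives `R y ∈
  -- K`.
  obtain ⟨C, hC⟩ := (S.range ⊓ K).exists_isCompl
  have hsup : (S.range ⊓ K) ⊔ (C ⊓ K) = K := by
    rw [← sup_inf_assoc_of_le C inf_le_right, hC.sup_eq_top, top_inf_eq]
  have hd : Disjoint (C ⊓ K) S.range := by
    rw [disjoint_iff, inf_assoc, inf_comm K, inf_comm, hC.inf_eq_bot]
  obtain ⟨G, hCG, hG⟩ := hd.exists_isCompl
  obtain ⟨D, hD⟩ := hF.closedComplemented_ker.exists_isTopCompl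
  let P := hF.fredholmPackage hD
    (Submodule.IsCompl.isTopCompl_of_finiteDimensional_quotient hG.symm hF.isClosed_range)
  have h1 : ∀ x, S (P.quasiInverse x) = P.decCodom.proj x := fun x ↦ by
    refine (DFunLike.congr_fun P.eq_equiv _).trans ?_
    simp [ContinuousLinearMap.FredholmPackage.quasiInverse]
  have h2 : ∀ x, S (P.quasiInverse (S x)) = S x := fun x ↦ by
    rw [h1]
    exact congrArg Subtype.val (Submodule.projectionOnto_apply_left hG.symm ⟨S x, ⟨x, rfl⟩⟩)
  refine ⟨P.quasiInverse, fun x hx ↦ ?_, h2⟩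
  rw [← hsup] at hx
  obtain ⟨_, ⟨⟨y, rfl⟩, hy⟩, g, hg, rfl⟩ := Submodule.mem_sup.1 hx
  have hRg : P.quasiInverse g = 0 := by
    have : P.decCodom.proj g = 0 :=
      Submodule.projectionOnto_apply_right hG.symm ⟨g, hCG hg⟩
    simp [ContinuousLinearMap.FredholmPackage.quasiInverse, this]
  rw [map_add, hRg, add_zero]
  refine hK _ ?_
  rw [← ContinuousLinearMap.coe_coe S, ContinuousLinearMap.coe_coe, h2]
  exact hy

theorem algFredholm_pow {S : M →L[ℂ] M} (hS : AlgFredholm (S : M →ₗ[ℂ] M)) (k : ℕ) :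
    AlgFredholm ((S ^ k : M →L[ℂ] M) : M →ₗ[ℂ] M) := by
  induction k with
  | zero => exact .of_bijective bijective_id
  | succ k ih =>
    rw [pow_succ]
    exact ih.comp hS

theorem isQuasiNilpotent_of_pow_eq_zero {S : M →L[ℂ] M} {k : ℕ} (h : S ^ k = 0) :
    IsQuasiNilpotent S := by
  intro c hc
  by_contra hc0
  rw [spectrum.mem_iff, sub_eq_add_neg] at hc
  refine hc (IsNilpotent.isUnit_add_left_of_commute (IsNilpotent.neg ⟨k, h⟩) ?_ ?_)
  · exact (IsUnit.mk0 c hc0).map _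
  · exact (Algebra.commutes c _).symm

end Adapted

/-! ### Restriction to the kernel of an eigenfunctional: basic cases and the intertwiner -/

section Codim

variable {X M N : Type*} [NormedAddCommGroup X] [NormedSpace ℂ X]
  [NormedAddCommGroup M] [NormedSpace ℂ M] [NormedAddCommGroup N] [NormedSpace ℂ N]
  {T : X →L[ℂ] X} {i : M →L[ℂ] X} {j : N →L[ℂ] X} {S : M →L[ℂ] M} {W : N →L[ℂ] N}
  {φ : X →L[ℂ] ℂ} {μ : ℂ}

theorem mapsTo_ker (hφ : ∀ x, φ (T x) = μ * φ x) : Set.MapsTo T φ.ker φ.ker := fun x hx ↦ by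
  have hx' : φ x = 0 := hx
  change φ (T x) = 0
  rw [hφ, hx', mul_zero]

theorem IsDecomp.restrict_ker (h : IsDecomp T i j S W) (hφ : ∀ x, φ (T x) = μ * φ x)
    (hi : ∀ m, φ (i m) = 0) :
    IsDecomp (T.restrict (mapsTo_ker hφ)) (i.codRestrict φ.ker hi)
      (j.restrict (p := (φ ∘L j).ker) (q := φ.ker) fun _ hx ↦ hx) S
      (W.restrict (mapsTo_ker (φ := φ ∘L j) (μ := μ) fun x ↦ by simp [← h.right, hφ])) := by
  refine ⟨⟨fun ⟨m, n⟩ ⟨m', n'⟩ he ↦ ?_, fun ⟨x, hx⟩ ↦ ?_⟩, fun x ↦ Subtype.ext (h.left x),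
    fun x ↦ Subtype.ext (h.right x)⟩
  · have := h.eq_of_eq (m := m) (m' := m') (n := n) (n' := n') (congrArg Subtype.val he)
    exact Prod.ext this.1 (Subtype.ext this.2)
  · obtain ⟨m, n, rfl⟩ := h.exists_eq x
    have hn : φ (j n) = 0 := by
      have : φ (i m + j n) = 0 := hx
      simpa [hi] using this
    exact ⟨(m, ⟨n, hn⟩), rfl⟩

theorem finiteDimensional_quotient_ker (ψ : N →L[ℂ] ℂ) : FiniteDimensional ℂ (N ⧸ ψ.ker) :=
  Submodule.CoFG.ker (ψ : N →ₗ[ℂ] ℂ)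

/-- The left summand becomes the graph of `L`; the relation `W L = L S` is what makes this graph
invariant, with `T` still acting on it as `S`. -/
theorem IsDecomp.shear (h : IsDecomp T i j S W) {L : M →L[ℂ] N} (hL : ∀ x, W (L x) = L (S x)) :
    IsDecomp T (i + j ∘L L) j S W := by
  refine ⟨⟨fun ⟨m, n⟩ ⟨m', n'⟩ he ↦ ?_, fun x ↦ ?_⟩, fun x ↦ ?_, h.right⟩
  · have := h.eq_of_eq (m := m) (m' := m') (n := L m + n) (n' := L m' + n')
      (by simpa [add_assoc] using he)
    obtain ⟨rfl, h2⟩ := this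
    rw [add_left_cancel h2]
  · obtain ⟨m, n, rfl⟩ := h.exists_eq x
    exact ⟨(m, n - L m), by simp⟩
  · simp [h.left, h.right, hL]

variable [CompleteSpace X] [CompleteSpace M] [CompleteSpace N]

theorem IsDecomp.isPseudoBFredholm_restrict_of_left (h : IsDecomp T i j S W)
    (hS : AlgFredholm (S : M →ₗ[ℂ] M)) (hW : IsQuasiNilpotent W)
    (hφ : ∀ x, φ (T x) = μ * φ x) (hi : ∀ m, φ (i m) = 0) :
    IsPseudoBFredholm (T.restrict (mapsTo_ker hφ)) := by
  have := φ.isClosed_ker.completeSpace_coe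
  have := (φ ∘L j).isClosed_ker.completeSpace_coe
  have := finiteDimensional_quotient_ker (φ ∘L j)
  exact (h.restrict_ker hφ hi).isPseudoBFredholm hS
    (hW.of_intertwine (i := (φ ∘L j).ker.subtypeL) (.subtype _) Subtype.val_injective fun _ ↦ rfl)

theorem IsDecomp.isPseudoBFredholm_restrict_of_right (h : IsDecomp T i j S W)
    (hS : AlgFredholm (S : M →ₗ[ℂ] M)) (hW : IsQuasiNilpotent W)
    (hφ : ∀ x, φ (T x) = μ * φ x) (hj : ∀ n, φ (j n) = 0) :
    IsPseudoBFredholm (T.restrict (mapsTo_ker hφ)) := by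
  have := φ.isClosed_ker.completeSpace_coe
  have := (φ ∘L i).isClosed_ker.completeSpace_coe
  have := finiteDimensional_quotient_ker (φ ∘L i)
  refine (h.symm.restrict_ker hφ hj).symm.isPseudoBFredholm ?_ hW
  exact (algFredholm_iff_of_intertwine (.subtype (φ ∘L i).ker) (by ext x; rfl)).2 hS

/-- The solution `L = ∑ Wᵏ n₀ ⊗ f Rᵏ` of `W L = L S`. -/
theorem exists_intertwiner (hS : AlgFredholm (S : M →ₗ[ℂ] M)) (hW : IsQuasiNilpotent W)
    {f : M →L[ℂ] ℂ} {g : N →L[ℂ] ℂ} (hf : ∀ x, f (S x) = 0) (hg : ∀ x, g (W x) = 0)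
    (hker : ∀ k x, (S ^ k) x = 0 → f x = 0) {n₀ : N} (hn₀ : g n₀ = -1) :
    ∃ L : M →L[ℂ] N, (∀ x, W (L x) = L (S x)) ∧ ∀ x, g (L x) = - f x := by
  -- `K` is the union of the `ker Sᵏ`. An inverse `R` preserving `K` makes every `f Rᵏ` vanish on
  -- `K`, in particular on `R S x - x ∈ ker S`; hence `f Rᵏ⁺¹ S = f Rᵏ`.
  let K : Submodule ℂ M := Module.End.maxGenEigenspace (S : M →ₗ[ℂ] M) 0
  have hKmem : ∀ x, x ∈ K ↔ ∃ k, (S ^ k) x = 0 := fun x ↦ by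
    simp [K, Module.End.mem_maxGenEigenspace, ← ContinuousLinearMap.toLinearMap_pow]
  obtain ⟨R, hRK, hR⟩ := exists_adapted_inverse hS (K := K) fun x hx ↦ by
    obtain ⟨k, hk⟩ := (hKmem _).1 hx
    exact (hKmem _).2 ⟨k + 1, by rwa [pow_succ]⟩
  let h : ℕ → M →L[ℂ] ℂ := fun k ↦ f ∘L (R ^ k)
  have hK : ∀ k x, x ∈ K → h k x = 0 := fun k ↦ by
    induction k with
    | zero =>
      intro x hx
      obtain ⟨l, hl⟩ := (hKmem _).1 hx
      exact hker l x hl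
    | succ k ih =>
      intro x hx
      have := ih _ (hRK x hx)
      simpa [h, pow_succ] using this
  have hS' : ∀ k x, h (k + 1) (S x) = h k x := fun k x ↦ by
    have h1 : h k (R (S x) - x) = 0 := hK k _ ((hKmem _).2 ⟨1, by simp [hR]⟩)
    have h2 : h (k + 1) (S x) = h k (R (S x)) := by simp [h, pow_succ]
    rw [h2, ← sub_eq_zero, ← map_sub, h1]
  have hsum : Summable fun k ↦ (h k).smulRight ((W ^ k) n₀) := by
    refine Summable.of_norm_bounded
      (g := fun k ↦ ‖f‖ * (‖W ^ k‖ * ‖R‖ ^ k) * ‖n₀‖)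
      (((hW.summable (norm_nonneg R)).mul_left _).mul_right _) fun k ↦ ?_
    rw [ContinuousLinearMap.norm_smulRight_apply]
    have h1 : ‖h k‖ ≤ ‖f‖ * ‖R‖ ^ k := by
      refine (ContinuousLinearMap.opNorm_comp_le _ _).trans ?_
      gcongr
      rcases k.eq_zero_or_pos with rfl | hk
      · rw [pow_zero, pow_zero]
        exact ContinuousLinearMap.norm_id_le
      · exact norm_pow_le' R hk
    calc _ ≤ (‖f‖ * ‖R‖ ^ k) * (‖W ^ k‖ * ‖n₀‖) := by
          gcongr
          exact (W ^ k).le_opNorm n₀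
      _ = _ := by ring
  obtain ⟨L, hL⟩ := hsum
  have hLx : ∀ x, HasSum (fun k ↦ h k x • (W ^ k) n₀) (L x) := fun x ↦
    hL.mapL (ContinuousLinearMap.apply ℂ N x)
  refine ⟨L, fun x ↦ ?_, fun x ↦ ?_⟩
  · refine ((hLx x).mapL W).unique ?_
    -- In the series for `L (S x)` the term `k = 0` vanishes because `f S = 0`; shifting the rest
    -- gives `W (L x)`.
    have h1 := (hasSum_nat_add_iff' 1).2 (hLx (S x))
    have h0 : h 0 (S x) = 0 := hf x
    simp only [hS', Finset.range_one, Finset.sum_singleton, h0, zero_smul, sub_zero] at h1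
    convert h1 using 2 with k
    simp [pow_succ']
  · refine ((hLx x).mapL g).unique ?_
    -- Since `g W = 0`, only the term `k = 0` survives, namely `f x * g n₀ = -f x`.
    have h1 := hasSum_single (f := fun k ↦ g (h k x • (W ^ k) n₀)) 0 fun k hk ↦ by
      obtain ⟨k, rfl⟩ := Nat.exists_eq_succ_of_ne_zero hk
      simp [pow_succ', hg]
    convert h1 using 1
    simp [h, hn₀]

end Codim

/-! ### Splitting off a Jordan chain -/

section Nilpotent

variable {M : Type*} [NormedAddCommGroup M] [NormedSpace ℂ M] {S : M →L[ℂ] M}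

/-- The subspace spanned by the first `l + 1` vectors of the orbit of `m` under `S`. -/
noncomputable def orbitSpan (S : M →L[ℂ] M) (m : M) (l : ℕ) : Submodule ℂ M :=
  Submodule.span ℂ (Set.range fun t : Fin (l + 1) ↦ (S ^ (t : ℕ)) m)

/-- The vectors whose orbit under `S` is annihilated by `h`. -/
noncomputable def orbitKer (S : M →L[ℂ] M) (h : M →L[ℂ] ℂ) : Submodule ℂ M :=
  ⨅ t : ℕ, (h ∘L (S ^ t)).ker

theorem mem_orbitKer {h : M →L[ℂ] ℂ} {x : M} : x ∈ orbitKer S h ↔ ∀ t : ℕ, h ((S ^ t) x) = 0 := by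
  simp only [orbitKer, Submodule.mem_iInf]
  rfl

theorem isClosed_orbitKer (h : M →L[ℂ] ℂ) : IsClosed (orbitKer S h : Set M) := by
  rw [orbitKer, Submodule.coe_iInf]
  exact isClosed_iInter fun t ↦ (h ∘L (S ^ t)).isClosed_ker

theorem mapsTo_orbitKer (h : M →L[ℂ] ℂ) : Set.MapsTo S (orbitKer S h) (orbitKer S h) := by
  intro x hx
  refine mem_orbitKer.2 fun t ↦ ?_
  simpa [pow_succ] using mem_orbitKer.1 hx (t + 1)

instance (m : M) (l : ℕ) : FiniteDimensional ℂ (orbitSpan S m l) :=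
  FiniteDimensional.span_of_finite ℂ (Set.finite_range _)

theorem pow_apply_eq_zero_of_le {m : M} {l t : ℕ} (hm : (S ^ l) m = 0) (ht : l ≤ t) :
    (S ^ t) m = 0 := by
  obtain ⟨s, rfl⟩ := Nat.exists_eq_add_of_le' ht
  rw [pow_add, mul_apply_eq_comp, hm, map_zero]

theorem pow_apply_mem_orbitSpan {m : M} {l : ℕ} (hm : (S ^ (l + 1)) m = 0) (t : ℕ) :
    (S ^ t) m ∈ orbitSpan S m l := by
  by_cases ht : t < l + 1
  · exact Submodule.subset_span ⟨⟨t, ht⟩, rfl⟩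
  · rw [pow_apply_eq_zero_of_le hm (not_lt.1 ht)]
    exact zero_mem _

theorem mapsTo_orbitSpan {m : M} {l : ℕ} (hm : (S ^ (l + 1)) m = 0) :
    Set.MapsTo S (orbitSpan S m l) (orbitSpan S m l) := by
  have : orbitSpan S m l ≤ (orbitSpan S m l).comap S.toLinearMap := by
    conv_lhs => rw [orbitSpan]
    rw [Submodule.span_le]
    rintro _ ⟨t, rfl⟩
    change S ((S ^ (t : ℕ)) m) ∈ orbitSpan S m l
    rw [← mul_apply_eq_comp, ← pow_succ']
    exact pow_apply_mem_orbitSpan hm _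
  exact this

theorem pow_succ_apply_orbitSpan {m : M} {l : ℕ} (hm : (S ^ (l + 1)) m = 0) {x : M}
    (hx : x ∈ orbitSpan S m l) : (S ^ (l + 1)) x = 0 := by
  have : orbitSpan S m l ≤ (S ^ (l + 1)).ker := by
    rw [orbitSpan, Submodule.span_le]
    rintro _ ⟨t, rfl⟩
    change (S ^ (l + 1)) ((S ^ (t : ℕ)) m) = 0
    rw [← mul_apply_eq_comp, ← pow_add, add_comm, pow_add,
      mul_apply_eq_comp, hm, map_zero]
  exact this hx

theorem isQuasiNilpotent_restrict_orbitSpan {m : M} {l : ℕ} (hm : (S ^ (l + 1)) m = 0) :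
    IsQuasiNilpotent (S.restrict (mapsTo_orbitSpan hm)) := by
  refine isQuasiNilpotent_of_pow_eq_zero (k := l + 1) ?_
  have : ∀ (k : ℕ) (x : orbitSpan S m l),
      (((S.restrict (mapsTo_orbitSpan hm)) ^ k) x : M) = (S ^ k) x := fun k ↦ by
    induction k with
    | zero => intro x; rfl
    | succ k ih => intro x; rw [pow_succ, pow_succ]; exact ih _
  ext x
  rw [this]
  exact pow_succ_apply_orbitSpan hm x.2

/-- The pairing `h (Sᵗ (Sˢ m))` for `s, t ≤ l` is anti-triangular: `1` where `s + t = l`, and `0`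
where `s + t > l`. So the functionals `h Sᵗ` restrict to a basis of the dual of the chain, and those
with `t > l` vanish identically. -/
theorem isCompl_orbitKer {m : M} {l : ℕ} (hm : (S ^ (l + 1)) m = 0) {h : M →L[ℂ] ℂ}
    (h1 : h ((S ^ l) m) = 1) (h0 : ∀ x, h ((S ^ (l + 1)) x) = 0) :
    IsCompl (orbitKer S h) (orbitSpan S m l) := by
  have hz : ∀ t, l < t → (S ^ t) m = 0 := fun t ht ↦ pow_apply_eq_zero_of_le hm ht
  have hz' : ∀ t x, l < t → h ((S ^ t) x) = 0 := fun t x ht ↦ by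
    obtain ⟨s, rfl⟩ := Nat.exists_eq_add_of_le (Nat.succ_le_of_lt ht)
    rw [pow_add, mul_apply_eq_comp]
    exact h0 _
  constructor
  · rw [Submodule.disjoint_def]
    intro x hx hx'
    rw [mem_orbitKer] at hx
    obtain ⟨c, rfl⟩ := (Submodule.mem_span_range_iff_exists_fun ℂ).1 hx'
    -- Testing with `h S^(l - n)` isolates `c n`: later terms vanish since `S^(l + 1) m = 0`,
    -- earlier ones by induction.
    have hc : ∀ n (hn : n < l + 1), c ⟨n, hn⟩ = 0 := by
      intro n
      induction n using Nat.strong_induction_on with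
      | _ n ih =>
        intro hn
        have h2 := hx (l - n)
        rw [map_sum, map_sum, Finset.sum_eq_single ⟨n, hn⟩] at h2
        · rw [map_smul, map_smul, ← mul_apply_eq_comp, ← pow_add,
            Nat.sub_add_cancel (Nat.le_of_lt_succ hn), h1] at h2
          simpa using h2
        · rintro ⟨t, ht⟩ - hne
          have hne' : t ≠ n := fun h ↦ hne (Fin.ext h)
          rcases lt_or_gt_of_ne hne' with hlt | hlt
          · rw [ih t hlt ht, zero_smul, map_zero, map_zero]
          · rw [map_smul, ← mul_apply_eq_comp, ← pow_add, hz _ (by simp; lia),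
              smul_zero, map_zero]
        · simp
    exact Finset.sum_eq_zero fun t _ ↦ by rw [hc t t.2, zero_smul]
  · rw [codisjoint_iff_le_sup]
    rintro x -
    -- Back substitution: each step adds a multiple of `Sˢ m` to annihilate `h S^(l - s)`, without
    -- disturbing the functionals `h Sᵗ` with `t > l - s`. At `s = l + 1` all of them vanish.
    have key : ∀ s, s ≤ l + 1 → ∃ e ∈ orbitSpan S m l,
        ∀ t, l < t + s → h ((S ^ t) (x - e)) = 0 := by
      intro s
      induction s with
      | zero => exact fun _ ↦ ⟨0, zero_mem _, fun t ht ↦ hz' t _ ht⟩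
      | succ s ih =>
        intro hs
        obtain ⟨e, he, hes⟩ := ih (by lia)
        refine ⟨e + h ((S ^ (l - s)) (x - e)) • (S ^ s) m, add_mem he
          (Submodule.smul_mem _ _ (pow_apply_mem_orbitSpan hm s)), fun t ht ↦ ?_⟩
        rw [← sub_sub, map_sub, map_sub, map_smul, map_smul, ← mul_apply_eq_comp,
          ← pow_add]
        rcases eq_or_ne t (l - s) with rfl | hne
        · rw [Nat.sub_add_cancel (by lia), h1]
          simp
        · rw [hz _ (by lia), hes t (by lia)]
          simp
    obtain ⟨e, he, hes⟩ := key (l + 1) le_rfl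
    rw [← sub_add_cancel x e]
    exact Submodule.add_mem_sup (mem_orbitKer.2 fun t ↦ hes t (by lia)) he

end Nilpotent

/-! ### Restriction to the kernel of an eigenfunctional: the general case -/

section Codim

variable {X M N : Type*} [NormedAddCommGroup X] [NormedSpace ℂ X]
  [NormedAddCommGroup M] [NormedSpace ℂ M] [NormedAddCommGroup N] [NormedSpace ℂ N]
  {T : X →L[ℂ] X} {i : M →L[ℂ] X} {j : N →L[ℂ] X} {S : M →L[ℂ] M} {W : N →L[ℂ] N}
  {φ : X →L[ℂ] ℂ} {μ : ℂ}

/-- Moving an invariant summand from the left to the right. -/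
theorem IsDecomp.move (h : IsDecomp T i j S W) {A E : Submodule ℂ M} (hc : IsCompl A E)
    (hA : Set.MapsTo S A A) (hE : Set.MapsTo S E E) :
    IsDecomp T (i ∘L A.subtypeL) (j.coprod (i ∘L E.subtypeL)) (S.restrict hA)
      (W.prodMap (S.restrict hE)) := by
  refine ⟨⟨?_, fun x ↦ ?_⟩, fun x ↦ h.left x, fun x ↦ ?_⟩
  · rintro ⟨a, n, e⟩ ⟨a', n', e'⟩ he
    have h1 := h.eq_of_eq (m := a + e) (m' := a' + e') (n := n) (n' := n') (by
      simp only [ContinuousLinearMap.coprod_apply, ContinuousLinearMap.comp_apply,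
        Submodule.subtypeL_apply] at he
      rw [map_add, map_add, add_assoc, add_assoc, add_comm (i e), add_comm (i e')]
      exact he)
    obtain ⟨h2, rfl⟩ := h1
    have h3 := (A.prodEquivOfIsCompl E hc).injective (a₁ := (a, e)) (a₂ := (a', e')) h2
    simp only [Prod.mk.injEq] at h3
    rw [h3.1, h3.2]
  · obtain ⟨m, n, rfl⟩ := h.exists_eq x
    obtain ⟨a, ha, e, he, rfl⟩ := Submodule.mem_sup.1 (hc.sup_eq_top ▸ Submodule.mem_top : m ∈ _)
    refine ⟨(⟨a, ha⟩, n, ⟨e, he⟩), ?_⟩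
    simp only [ContinuousLinearMap.coprod_apply, ContinuousLinearMap.comp_apply,
        Submodule.subtypeL_apply, map_add]
    abel
  · simp only [ContinuousLinearMap.coprod_apply, ContinuousLinearMap.comp_apply,
      Submodule.subtypeL_apply, map_add, h.left, h.right]
    rfl

variable [CompleteSpace X] [CompleteSpace M] [CompleteSpace N]

theorem IsDecomp.isPseudoBFredholm_restrict_ker (h : IsDecomp T i j S W)
    (hS : AlgFredholm (S : M →ₗ[ℂ] M)) (hW : IsQuasiNilpotent W)
    (hφ : ∀ x, φ (T x) = μ * φ x) : IsPseudoBFredholm (T.restrict (mapsTo_ker hφ)) := by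
  by_cases hj : ∀ n, φ (j n) = 0
  · exact h.isPseudoBFredholm_restrict_of_right hS hW hφ hj
  push Not at hj
  obtain ⟨n, hn⟩ := hj
  -- For `μ ≠ 0` the operator `W - μ` is onto, while `φ ∘ j` vanishes on its range.
  have hμ : μ = 0 := by
    by_contra hμ
    obtain ⟨y, rfl⟩ := (isQuasiNilpotent_iff.1 hW μ hμ).2 n
    apply hn
    simp [← h.right, hφ]
  subst hμ
  have hg : ∀ x, (φ ∘L j) (W x) = 0 := fun x ↦ by simp [← h.right, hφ]
  have hf : ∀ x, (φ ∘L i) (S x) = 0 := fun x ↦ by simp [← h.left, hφ]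
  by_cases hker : ∀ k x, (S ^ k) x = 0 → (φ ∘L i) x = 0
  · obtain ⟨L, hL, hLf⟩ := exists_intertwiner hS hW hf hg hker (n₀ := -(φ (j n))⁻¹ • n)
      (by simp [hn])
    refine (h.shear hL).isPseudoBFredholm_restrict_of_left hS hW hφ fun m ↦ ?_
    have := hLf m
    simp only [ContinuousLinearMap.comp_apply] at this
    simp [this]
  · push Not at hker
    classical
    -- With `l + 1` the least exponent such that `φ ∘ i` is nonzero on `ker S^(l + 1)`, the
    -- functional `φ ∘ i` vanishes on `ker Sˡ`.
    have hk := Nat.find_spec hker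
    have hmin : ∀ t < Nat.find hker, ∀ x, (S ^ t) x = 0 → (φ ∘L i) x = 0 := fun t ht ↦ by
      simpa using Nat.find_min hker ht
    generalize Nat.find hker = k at hk hmin
    obtain ⟨m, hm, hm0⟩ := hk
    obtain ⟨l, rfl⟩ : ∃ l, k = l + 1 := Nat.exists_eq_succ_of_ne_zero fun hk0 ↦ by
      subst hk0
      have : m = 0 := hm
      simp [this] at hm0
    -- Hence `φ ∘ i` factors through `Sˡ` as `h Sˡ` with `h = φ ∘ i ∘ R`. This continuous `h`
    -- satisfies `h S^(l + 1) = φ ∘ i ∘ S = 0`, and rescaling `m` gives `h (Sˡ m) = 1`.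
    obtain ⟨R, -, hR⟩ := exists_adapted_inverse (algFredholm_pow hS l) (K := ⊤) (by simp)
    have hfac : ∀ x, (φ ∘L i ∘L R) ((S ^ l) x) = (φ ∘L i) x := fun x ↦ by
      have := hmin l (Nat.lt_succ_self l) (R ((S ^ l) x) - x) (by rw [map_sub, hR, sub_self])
      rw [map_sub, sub_eq_zero] at this
      exact this
    have hc := isCompl_orbitKer (S := S) (m := ((φ ∘L i) m)⁻¹ • m) (l := l) (h := φ ∘L i ∘L R)
      (by rw [map_smul, hm, smul_zero]) (by rw [hfac, map_smul, smul_eq_mul, inv_mul_cancel₀ hm0])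
      (fun x ↦ by rw [pow_succ, mul_apply_eq_comp, hfac, hf])
    have hm' : (S ^ (l + 1)) (((φ ∘L i) m)⁻¹ • m) = 0 := by rw [map_smul, hm, smul_zero]
    have := (isClosed_orbitKer (S := S) (φ ∘L i ∘L R)).completeSpace_coe
    have : FiniteDimensional ℂ (M ⧸ orbitKer S (φ ∘L i ∘L R)) :=
      (Submodule.quotientEquivOfIsCompl _ _ hc).symm.finiteDimensional
    refine (h.move hc (mapsTo_orbitKer _) (mapsTo_orbitSpan hm')).isPseudoBFredholm_restrict_of_left
      ((algFredholm_iff_of_intertwine (.subtype (orbitKer S (φ ∘L i ∘L R))) (by ext x; rfl)).2 hS)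
      (hW.prodMap (isQuasiNilpotent_restrict_orbitSpan hm')) hφ fun x ↦ ?_
    -- On `orbitKer` the condition with exponent `l` says exactly that `φ ∘ i` vanishes.
    have := mem_orbitKer.1 x.2 l
    rwa [hfac] at this

end Codim

/-! ### Finite codimension and the converse -/

section Main

variable {X : Type*} [NormedAddCommGroup X] [NormedSpace ℂ X] [CompleteSpace X] {T : X →L[ℂ] X}

theorem IsPseudoBFredholm.restrict_ker (hT : IsPseudoBFredholm T) {φ : X →L[ℂ] ℂ} {μ : ℂ}
    (hφ : ∀ x, φ (T x) = μ * φ x) : IsPseudoBFredholm (T.restrict (mapsTo_ker hφ)) := by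
  obtain ⟨M, N, h, hF, hq⟩ := hT
  have := h.isClosed_left.completeSpace_coe
  have := h.isClosed_right.completeSpace_coe
  exact h.isDecomp.isPseudoBFredholm_restrict_ker (algFredholm_of_isFredholm hF) hq hφ

theorem IsPseudoBFredholm.of_equiv {Y : Type*} [NormedAddCommGroup Y] [NormedSpace ℂ Y]
    [CompleteSpace Y] {T' : Y →L[ℂ] Y} (hT : IsPseudoBFredholm T) (e : X →L[ℂ] Y)
    (he : Bijective e) (h : ∀ x, T' (e x) = e (T x)) : IsPseudoBFredholm T' := by
  obtain ⟨M, N, hr, hF, hq⟩ := hT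
  have := hr.isClosed_left.completeSpace_coe
  have := hr.isClosed_right.completeSpace_coe
  have hd := hr.isDecomp
  refine IsDecomp.isPseudoBFredholm (i := e ∘L M.subtypeL) (j := e ∘L N.subtypeL) ⟨?_, ?_, ?_⟩
    (algFredholm_of_isFredholm hF) hq
  · have : ⇑((e ∘L M.subtypeL).coprod (e ∘L N.subtypeL)) =
        e ∘ M.subtypeL.coprod N.subtypeL := by
      ext x; simp
    rw [this]
    exact he.comp hd.bij
  · intro x
    exact h x
  · intro x
    exact h x

/-- Enlarging `A` by a lift `v` of an eigenvector on `X ⧸ A` gives an invariant `B` of smaller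
codimension, to which induction applies. Inside `B`, the subspace `A` is the kernel of the
coordinate along `v`, an eigenfunctional of `T_B`. -/
theorem IsPseudoBFredholm.restrict (hT : IsPseudoBFredholm T) {A : Submodule ℂ X}
    (hA : IsClosed (A : Set X)) (hinv : Set.MapsTo T A A) [FiniteDimensional ℂ (X ⧸ A)] :
    IsPseudoBFredholm (T.restrict hinv) := by
  induction hn : finrank ℂ (X ⧸ A) using Nat.strong_induction_on generalizing A with
  | _ n ih =>
  have := hA.completeSpace_coe
  rcases subsingleton_or_nontrivial (X ⧸ A) with hs | hs
  · rw [Submodule.Quotient.subsingleton_iff] at hs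
    subst hs
    exact hT.of_equiv ((ContinuousLinearMap.id ℂ X).codRestrict ⊤ fun _ ↦ trivial)
      ⟨fun x y hxy ↦ congrArg Subtype.val hxy, fun x ↦ ⟨x, rfl⟩⟩ fun _ ↦ rfl
  · obtain ⟨μ, hμ⟩ := Module.End.exists_eigenvalue (A.mapQ A (T : X →ₗ[ℂ] X) hinv)
    obtain ⟨v, hv⟩ := hμ.exists_hasEigenvector
    have hv0 := hv.2
    have hv1 := hv.apply_eq_smul
    obtain ⟨v, rfl⟩ := A.mkQ_surjective v
    have hTv : T v - μ • v ∈ A := by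
      rw [← Submodule.Quotient.eq]
      exact hv1
    set B : Submodule ℂ X := A ⊔ Submodule.span ℂ {v} with hB
    have hAB : A ≤ B := le_sup_left
    have hvB : v ∈ B := Submodule.mem_sup_right (Submodule.mem_span_singleton_self v)
    have hBc : IsClosed (B : Set X) := Submodule.isClosed_sup_finiteDimensional _ _ hA
    have hBmem : ∀ x ∈ B, ∃ a ∈ A, ∃ c : ℂ, x = a + c • v := fun x hx ↦ by
      obtain ⟨a, ha, y, hy, rfl⟩ := Submodule.mem_sup.1 hx
      obtain ⟨c, rfl⟩ := Submodule.mem_span_singleton.1 hy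
      exact ⟨a, ha, c, rfl⟩
    have hBinv : Set.MapsTo T B B := fun x hx ↦ by
      obtain ⟨a, ha, c, rfl⟩ := hBmem x hx
      have : T (a + c • v) = T a + c • (T v - μ • v) + (c * μ) • v := by
        rw [map_add, map_smul, smul_sub, smul_smul]
        abel
      rw [this]
      exact add_mem (hAB (add_mem (hinv ha) (A.smul_mem _ hTv))) (B.smul_mem _ hvB)
    have hlt : finrank ℂ (X ⧸ B) < n := by
      have h1 := LinearMap.finrank_range_add_finrank_ker (Submodule.factor hAB)
      rw [LinearMap.range_eq_top.2 (Submodule.factor_surjective hAB), finrank_top, hn] at h1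
      have h2 : 0 < finrank ℂ (Submodule.factor hAB).ker := by
        refine finrank_pos_iff_exists_ne_zero.2 ⟨⟨A.mkQ v, ?_⟩, fun h ↦ hv0 (congrArg Subtype.val h)⟩
        simpa using hvB
      lia
    have : FiniteDimensional ℂ (X ⧸ B) :=
      Module.Finite.of_surjective _ (Submodule.factor_surjective hAB)
    have hTB := ih _ hlt hBc hBinv rfl
    have := hBc.completeSpace_coe
    obtain ⟨ψ, hψ⟩ : ∃ ψ : (X ⧸ A) →ₗ[ℂ] ℂ, ψ (A.mkQ v) = 1 := by
      obtain ⟨ψ, hψ⟩ := not_forall.1 (mt (Module.forall_dual_apply_eq_zero_iff ℂ (A.mkQ v)).1 hv0)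
      exact ⟨(ψ (A.mkQ v))⁻¹ • ψ, by simpa using inv_mul_cancel₀ hψ⟩
    let φ : B →L[ℂ] ℂ := ψ.toContinuousLinearMap ∘L A.mkQL ∘L B.subtypeL
    have hφA : ∀ a (ha : a ∈ A), ψ (A.mkQ a) = 0 := fun a ha ↦ by
      rw [Submodule.mkQ_apply, (Submodule.Quotient.mk_eq_zero A).2 ha, map_zero]
    have hφ : ∀ x : B, φ x = ψ (A.mkQ x) := fun x ↦ rfl
    have hφc : ∀ a ∈ A, ∀ c : ℂ, ψ (A.mkQ (a + c • v)) = c := fun a ha c ↦ by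
      rw [map_add, map_add, map_smul, map_smul, hψ, hφA a ha]
      simp
    have hφT : ∀ x, φ (T.restrict hBinv x) = μ * φ x := by
      rintro ⟨x, hx⟩
      obtain ⟨a, ha, c, rfl⟩ := hBmem x hx
      have : T (a + c • v) = T a + c • (T v - μ • v) + (μ * c) • v := by
        rw [map_add, map_smul, smul_sub, smul_smul, mul_comm]
        abel
      rw [hφ, hφ, hφc a ha]
      change ψ (A.mkQ (T (a + c • v))) = _
      rw [this, hφc _ (add_mem (hinv ha) (A.smul_mem _ hTv))]
    have hker := hTB.restrict_ker hφT
    have := φ.isClosed_ker.completeSpace_coe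
    have hmem : ∀ x : φ.ker, ((x : B) : X) ∈ A := fun x ↦ by
      obtain ⟨a, ha, c, hx⟩ := hBmem x.1 x.1.2
      have h1 : ψ (A.mkQ x.1) = 0 := x.2
      rw [hx, hφc a ha] at h1
      rw [hx, h1, zero_smul, add_zero]
      exact ha
    refine hker.of_equiv ((B.subtypeL ∘L φ.ker.subtypeL).codRestrict A hmem)
      ⟨fun x y hxy ↦ Subtype.ext (Subtype.ext (congrArg (fun a : A ↦ (a : X)) hxy)),
        fun a ↦ ?_⟩ fun _ ↦ rfl
    exact ⟨⟨⟨a, hAB a.2⟩, hφA a a.2⟩, rfl⟩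

theorem IsPseudoBFredholm.of_restrict {A F : Submodule ℂ X} (hA : IsClosed (A : Set X))
    (hinv : Set.MapsTo T A A) [FiniteDimensional ℂ (X ⧸ A)] (hF : Set.MapsTo T F F)
    (hAF : IsCompl A F) (hT : IsPseudoBFredholm (T.restrict hinv)) : IsPseudoBFredholm T := by
  have : FiniteDimensional ℂ F := (A.quotientEquivOfIsCompl F hAF).finiteDimensional
  have := hA.completeSpace_coe
  obtain ⟨M, N, h, hS, hW⟩ := hT
  have := h.isClosed_left.completeSpace_coe
  have := h.isClosed_right.completeSpace_coe
  have hFc : IsClosed (F : Set X) := Submodule.closed_of_finiteDimensional F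
  have hd : IsDecomp T F.subtypeL A.subtypeL (T.restrict hF) (T.restrict hinv) :=
    Reduces.isDecomp ⟨hFc, hA, hF, hinv, hAF.symm⟩
  -- Regroups `X = (M ⊕ N) ⊕ F` as `(F ⊕ M) ⊕ N`. The inclusion of `M` in `F × M` has
  -- finite-dimensional cokernel, so the first block remains Fredholm.
  refine (hd.symm.move h.isCompl.symm h.mapsTo_right h.mapsTo_left).symm.isPseudoBFredholm ?_ hW
  refine (algFredholm_iff_of_intertwine (i := LinearMap.inr ℂ F M) ?_ ?_).1
    (algFredholm_of_isFredholm hS)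
  · exact (AlgFredholm.of_bijective (LinearEquiv.prodComm ℂ M F).bijective).comp algFredholm_inl
  · ext x <;> simp

end Main

end PseudoBFredholm

theorem mainTheorem11 {X : Type*} [NormedAddCommGroup X] [NormedSpace ℂ X] [CompleteSpace X]
    (T : X →L[ℂ] X) (A : Submodule ℂ X) (hA_closed : IsClosed (A : Set X))
    (hA_inv : Set.MapsTo T A A) (hA_codim : FiniteDimensional ℂ (X ⧸ A)) :
    (PseudoBFredholm.IsPseudoBFredholm T →
      PseudoBFredholm.IsPseudoBFredholm (T.restrict hA_inv) ∧
        PseudoBFredholm.index T = PseudoBFredholm.index (T.restrict hA_inv)) ∧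
    ((∃ F : Submodule ℂ X, Set.MapsTo T F F ∧ IsCompl A F) →
      PseudoBFredholm.IsPseudoBFredholm (T.restrict hA_inv) →
        PseudoBFredholm.IsPseudoBFredholm T ∧
          PseudoBFredholm.index T = PseudoBFredholm.index (T.restrict hA_inv)) := by
  constructor
  · intro hT
    have hTA := hT.restrict hA_closed hA_inv
    exact ⟨hTA, PseudoBFredholm.index_restrict_eq hA_closed hA_inv hT hTA⟩
  · rintro ⟨F, hF, hAF⟩ hTA
    have hT := PseudoBFredholm.IsPseudoBFredholm.of_restrict hA_closed hA_inv hF hAF hTA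
    exact ⟨hT, PseudoBFredholm.index_restrict_eq hA_closed hA_inv hT hTA⟩
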